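/- **Setting.** A simple stochastic game (SSG) $G$ is a finite directed graph whose vertex set $V$ is partitioned into max vertices, min vertices, random vertices and a non-empty set of sinks. Every non-sink vertex has an outneighbour; the only arc leaving a sink is a loop. Each random vertex $x$ carries a probability distribution $p_x$ with $p_x(y)>0$ if and only if $(x,y)$ is an arc. Each sink $s$ carries a value $\mathrm{Val}(s)\in[0,1]$. (Probabilities and values may be arbitrary real numbers, in particular rational.) A play follows the arcs; its value is $\mathrm{Val}(s)$ if it reaches a sink $s$, and $0$ if it reaches no sink. No stopping assumption is made. A general strategy of max (resp. min) assigns to every finite history ending in a max (resp. min) vertex an outneighbour of that vertex; a positional strategy depends only on the last vertex. For strategies $\sigma$ of max and $\tau$ of min, $v^G_{\sigma,\tau}(x)$ is the expected value of the random play started at $x$. For a positional max strategy $\sigma$ let $v^G_\sigma(x)=\inf_\tau v^G_{\sigma,\tau}(x)$, the infimum being over all general min strategies; thus $v^G_\sigma=v^G_{\sigma,\tau}$ for every best response $\tau$ to $\sigma$. For positional max strategies $\sigma,\sigma'$ write * $\sigma'\underset{G}{>}\sigma$ if $v^G_{\sigma'}(x)\ge v^G_\sigma(x)$ for all vertices $x$,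 with strict inequality for some $x$; * $\sigma'\underset{G}{\succ}\sigma$ if $\sigma'\underset{G}{>}\sigma$ and, for every max vertex $x$, $v^G_{\sigma'}(x)=v^G_\sigma(x)$ implies $\sigma'(x)=\sigma(x)$. For a set $A$ of arcs of $G$ and a positional max strategy $\sigma$, the game $G[A,\sigma]$ is obtained from $G$ by replacing each arc $e=(x,y)\in A$ with $x$ not a sink by an arc $(x,s_e)$, where $s_e$ is a new sink of value $v^G_\sigma(y)$; loops at sinks of $G$ are kept, and at a random vertex the new arc inherits the probability $p_x(y)$. Positional strategies of $G$ are identified with those of $G[A,\sigma]$ in the obvious way (choosing $(x,s_e)$ instead of $e=(x,y)$ when $e\in A$). **Proposition.** Let $G$ be an SSG, $A$ a set of arcs of $G$, and $\sigma,\sigma'$ two positional max strategies of $G$. If $\sigma'\underset{G[A,\sigma]}{\succ}\sigma$, then $\sigma'\underset{G}{>}\sigma$. -/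

import Mathlib

open ProbabilityTheory MeasureTheory

universe u

/-- The four kinds of vertices of a simple stochastic game. -/
inductive VertexKind
  | max
  | min
  | random
  | sink

/-- A (finite) simple stochastic game. The map `kind` encodes the partition of the vertex set into
max vertices, min vertices, random vertices and sinks; `Adj x y` says that `(x, y)` is an arc.
Transition probabilities and sink values are allowed to be arbitrary real numbers, which covers the
case where they are rational. -/
structure SSG where
  /-- the vertex set -/
  V : Type u
  finite : Finite V
  kind : V → VertexKind
  /-- the arcs -/
  Adj : V → V → Prop
  exists_sink : ∃ s, kind s = .sink
  exists_adj : ∀ x, kind x ≠ .sink → ∃ y, Adj x y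
  adj_sink : ∀ s, kind s = .sink → ∀ y, Adj s y ↔ y = s
  /-- the probability distribution used at a random vertex -/
  prob : ∀ x, kind x = .random → PMF V
  adj_random : ∀ x (hx : kind x = .random) (y : V), Adj x y ↔ 0 < prob x hx y
  /-- the value of a sink, a number in `[0, 1]` -/
  sinkVal : ∀ s, kind s = .sink → unitInterval

namespace SSG

attribute [instance] SSG.finite

instance (G : SSG) : MeasurableSpace G.V := ⊤

instance (G : SSG) : DiscreteMeasurableSpace G.V := ⟨fun _ => trivial⟩

noncomputable section

/-- The set of arcs. -/
def arcs (G : SSG) : Set (G.V × G.V) := {e | G.Adj e.1 e.2}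

/-! ### Histories and strategies -/

/-- Sequences `(x_0, …, x_n)` of vertices. -/
abbrev Hist (G : SSG) (n : ℕ) := Finset.Iic n → G.V

/-- The last vertex `x_n` of `(x_0, …, x_n)`. -/
def last (G : SSG) {n : ℕ} (h : G.Hist n) : G.V := h ⟨n, Finset.mem_Iic.2 le_rfl⟩

/-- General (history-dependent, deterministic) max strategies. They are defined on all finite
sequences of vertices that end in a max vertex; the values on sequences that are not paths play no
role, since a random play follows the arcs. -/
def GenMaxStrategy (G : SSG) :=
  ∀ (n : ℕ) (h : G.Hist n), G.kind (G.last h) = .max → {y : G.V // G.Adj (G.last h) y}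

/-- General (history-dependent, deterministic) min strategies. -/
def GenMinStrategy (G : SSG) :=
  ∀ (n : ℕ) (h : G.Hist n), G.kind (G.last h) = .min → {y : G.V // G.Adj (G.last h) y}

/-- Positional max strategies: an outneighbour for each max vertex. -/
def MaxStrategy (G : SSG) := ∀ x : G.V, G.kind x = .max → {y : G.V // G.Adj x y}

/-- Positional min strategies: an outneighbour for each min vertex. -/
def MinStrategy (G : SSG) := ∀ x : G.V, G.kind x = .min → {y : G.V // G.Adj x y}

/-- A positional max strategy, seen as a general one that only looks at the last vertex. -/
def MaxStrategy.toGen {G : SSG} (σ : G.MaxStrategy) : G.GenMaxStrategy :=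
  fun _ h hx => σ (G.last h) hx

/-- A positional min strategy, seen as a general one that only looks at the last vertex. -/
def MinStrategy.toGen {G : SSG} (τ : G.MinStrategy) : G.GenMinStrategy :=
  fun _ h hx => τ (G.last h) hx

/-! ### Random plays and values -/

/-- The law of `X_{n+1}` given the history `h = (X_0, …, X_n)`. -/
def next (G : SSG) (σ : G.GenMaxStrategy) (τ : G.GenMinStrategy) (n : ℕ) (h : G.Hist n) :
    PMF G.V :=
  match hk : G.kind (G.last h) with
  | .max => PMF.pure (σ n h hk).1
  | .min => PMF.pure (τ n h hk).1
  | .random => G.prob (G.last h) hk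
  | .sink => PMF.pure (G.last h)

/-- `next` as a Markov kernel. -/
def nextKernel (G : SSG) (σ : G.GenMaxStrategy) (τ : G.GenMinStrategy) (n : ℕ) :
    Kernel (G.Hist n) G.V :=
  Kernel.ofFunOfCountable fun h => (G.next σ τ n h).toMeasure

instance (G : SSG) (σ : G.GenMaxStrategy) (τ : G.GenMinStrategy) (n : ℕ) :
    IsMarkovKernel (G.nextKernel σ τ n) :=
  ⟨fun h => PMF.toMeasure.isProbabilityMeasure (G.next σ τ n h)⟩

/-- The law of the random play `(X_0, X_1, …)` started at `X_0 = x` under the strategies `σ, τ`. -/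
def playLaw (G : SSG) (σ : G.GenMaxStrategy) (τ : G.GenMinStrategy) (x : G.V) :
    Measure (ℕ → G.V) :=
  Kernel.traj (X := fun _ => G.V) (G.nextKernel σ τ) 0 (fun _ => x)

instance (G : SSG) (σ : G.GenMaxStrategy) (τ : G.GenMinStrategy) (x : G.V) :
    IsProbabilityMeasure (G.playLaw σ τ x) := by
  unfold playLaw; infer_instance

open Classical in
/-- The value of a play: the value of the sink that it reaches, and `0` if it reaches no sink. -/
def playVal (G : SSG) (X : ℕ → G.V) : ℝ :=
  if h : ∃ t, G.kind (X t) = .sink then (G.sinkVal (X (Nat.find h)) (Nat.find_spec h) : ℝ) else 0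

/-- The value `v_{σ,τ}(x)`: the expected value of a random play started at `x`. -/
def value (G : SSG) (σ : G.GenMaxStrategy) (τ : G.GenMinStrategy) (x : G.V) : ℝ :=
  ∫ X, G.playVal X ∂(G.playLaw σ τ x)

/-- `τ` is a best response to `σ` (among all min strategies, positional or not). -/
def IsBestResponse (G : SSG) (σ : G.GenMaxStrategy) (τ : G.GenMinStrategy) : Prop :=
  ∀ τ' : G.GenMinStrategy, G.value σ τ ≤ G.value σ τ'

/-- The value vector `v_σ` of a positional max strategy: what `σ` guarantees against all min
strategies. By `maxVal_eq_of_isBestResponse` this is `v_{σ,τ}` for every best response `τ`. -/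
def maxVal (G : SSG) (σ : G.MaxStrategy) (x : G.V) : ℝ :=
  ⨅ τ : G.GenMinStrategy, G.value σ.toGen τ x

theorem playVal_mem (G : SSG) (X : ℕ → G.V) : G.playVal X ∈ unitInterval := by
  unfold playVal
  split_ifs
  · exact Subtype.property _
  · simp

theorem measurable_playVal (G : SSG) : Measurable G.playVal := by
  classical
  let g : G.V → ℝ := fun s => if h : G.kind s = .sink then (G.sinkVal s h : ℝ) else 0
  have hS : ∀ t, MeasurableSet {X : ℕ → G.V | G.kind (X t) = .sink} := fun t =>
    MeasurableSet.preimage (MeasurableSet.of_discrete (s := {x : G.V | G.kind x = .sink}))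
      (measurable_pi_apply t)
  have hE : MeasurableSet {X : ℕ → G.V | ∃ t, G.kind (X t) = .sink} := by
    rw [Set.ofPred_exists]; exact MeasurableSet.iUnion hS
  have hp : ∀ X : ℕ → G.V, ∃ t, G.kind (X t) = .sink ∨ ¬ ∃ t, G.kind (X t) = .sink := by
    intro X
    by_cases h : ∃ t, G.kind (X t) = .sink
    · exact h.imp fun _ => Or.inl
    · exact ⟨0, Or.inr h⟩
  have hq : ∀ t, MeasurableSet {X : ℕ → G.V | G.kind (X t) = .sink ∨
      ¬ ∃ t, G.kind (X t) = .sink} := fun t => (hS t).union hE.compl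
  have hf : ∀ t : ℕ, Measurable fun X : ℕ → G.V => g (X t) := fun t =>
    (Measurable.of_discrete (f := g)).comp (measurable_pi_apply t)
  have hm : Measurable fun X : ℕ → G.V => g (X (Nat.find (hp X))) :=
    Measurable.find (f := fun t (X : ℕ → G.V) => g (X t)) hf hq hp
  convert hm using 2 with X
  unfold playVal
  split_ifs with h
  · have e : Nat.find (hp X) = Nat.find h := by
      apply Nat.find_congr'
      intro n
      simp [h]
    have := Nat.find_spec h
    simp only [e, g, dif_pos this]
  · push Not at h
    simp [g, h]

theorem value_mem (G : SSG) (σ : G.GenMaxStrategy) (τ : G.GenMinStrategy) (x : G.V) :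
    G.value σ τ x ∈ unitInterval := by
  have hi : Integrable G.playVal (G.playLaw σ τ x) :=
    Integrable.of_mem_Icc 0 1 G.measurable_playVal.aemeasurable
      (Filter.Eventually.of_forall G.playVal_mem)
  refine ⟨integral_nonneg fun X => (G.playVal_mem X).1, ?_⟩
  calc G.value σ τ x ≤ ∫ _, (1 : ℝ) ∂(G.playLaw σ τ x) :=
        integral_mono hi (integrable_const _) fun X => (G.playVal_mem X).2
    _ = 1 := by simp

instance (G : SSG) : Nonempty G.GenMinStrategy := by
  refine ⟨fun n h hk => ?_⟩
  have := G.exists_adj (G.last h) (by simp [hk])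
  exact ⟨this.choose, this.choose_spec⟩

theorem bddBelow_value (G : SSG) (σ : G.GenMaxStrategy) (x : G.V) :
    BddBelow (Set.range fun τ => G.value σ τ x) :=
  ⟨0, by rintro _ ⟨τ, rfl⟩; exact (G.value_mem σ τ x).1⟩

theorem maxVal_mem (G : SSG) (σ : G.MaxStrategy) (x : G.V) : G.maxVal σ x ∈ unitInterval :=
  ⟨le_ciInf fun τ => (G.value_mem _ τ x).1,
    (ciInf_le (G.bddBelow_value _ x) (Classical.arbitrary _)).trans (G.value_mem _ _ x).2⟩

theorem maxVal_eq_of_isBestResponse (G : SSG) {σ : G.MaxStrategy} {τ : G.GenMinStrategy}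
    (h : G.IsBestResponse σ.toGen τ) : G.maxVal σ = G.value σ.toGen τ :=
  funext fun x => le_antisymm (ciInf_le (G.bddBelow_value _ x) τ) (le_ciInf fun τ' => h τ' x)

/-! ### Comparison of strategies -/

/-- `σ' > σ` in `G`: the value vector of `σ'` is at least that of `σ` at every vertex, and larger
at some vertex. -/
def Better (G : SSG) (σ' σ : G.MaxStrategy) : Prop :=
  (∀ x, G.maxVal σ x ≤ G.maxVal σ' x) ∧ ∃ x, G.maxVal σ x < G.maxVal σ' x

/-- `σ' ≻ σ` in `G`: `σ' > σ`, and `σ'` agrees with `σ` at each max vertex where they have the same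
value. -/
def StrictlyBetter (G : SSG) (σ' σ : G.MaxStrategy) : Prop :=
  G.Better σ' σ ∧ ∀ x (hx : G.kind x = .max), G.maxVal σ' x = G.maxVal σ x → σ' x hx = σ x hx

/-! ### The transformed game -/

open Classical in
/-- The endpoint, in the transformed game, of the arc `(x, y)`: the new sink `s_(x,y)` if
`(x, y) ∈ A`, and `y` otherwise. Loops at sinks of `G` are never redirected (the play is over
there, and the sinks have to remain sinks). -/
def redirect (G : SSG) (A : Set (G.V × G.V)) (x y : G.V) : G.V ⊕ A :=
  if h : (x, y) ∈ A ∧ G.kind x ≠ .sink then .inr ⟨(x, y), h.1⟩ else .inl y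

theorem redirect_injective (G : SSG) (A : Set (G.V × G.V)) (x : G.V) :
    Function.Injective (G.redirect A x) := by
  intro y z h
  unfold redirect at h
  split_ifs at h <;> simp_all

/-- The game `G[A, f]`: each arc `e ∈ A` is redirected to a new sink `s_e` (namely `Sum.inr e`) of
value `f e`. -/
def transform (G : SSG.{u}) (A : Set (G.V × G.V)) (f : A → unitInterval) : SSG.{u} where
  V := G.V ⊕ A
  finite := inferInstance
  kind
    | .inl x => G.kind x
    | .inr _ => .sink
  Adj
    | .inl x, b => ∃ y, G.Adj x y ∧ b = G.redirect A x y
    | .inr e, b => b = .inr e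
  exists_sink := G.exists_sink.imp' Sum.inl fun _ h => h
  exists_adj := by
    rintro (x | e) h
    · obtain ⟨y, hy⟩ := G.exists_adj x h
      exact ⟨_, y, hy, rfl⟩
    · exact absurd rfl h
  adj_sink := by
    rintro (x | e) h b
    · simp only at h
      simp [G.adj_sink x h, redirect, h]
    · rfl
  prob
    | .inl x, hx => (G.prob x hx).map (G.redirect A x)
    | .inr _, hx => nomatch hx
  adj_random := by
    rintro (x | e) h b
    · simp only at h
      simp only [pos_iff_ne_zero, ← PMF.mem_support_iff, PMF.support_map, Set.mem_image]
      exact exists_congr fun y => and_congr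
        (by rw [G.adj_random x h, pos_iff_ne_zero, PMF.mem_support_iff]) eq_comm
    · cases h
  sinkVal
    | .inl s, hs => G.sinkVal s hs
    | .inr e, _ => f e

/-- The game `G[A, σ]`: the game `G[A, f]` with `f (x, y) = v_σ(y)`. -/
def transformAt (G : SSG.{u}) (A : Set (G.V × G.V)) (σ : G.MaxStrategy) : SSG.{u} :=
  G.transform A fun e => ⟨G.maxVal σ e.1.2, G.maxVal_mem σ e.1.2⟩

/-- A max strategy `ρ` of `G`, seen as a max strategy of `G[A, σ]`: at a max vertex `x` it chooses
the arc that replaces the arc `(x, ρ x)`. -/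
def MaxStrategy.inTransform {G : SSG} (ρ : G.MaxStrategy) (A : Set (G.V × G.V))
    (σ : G.MaxStrategy) : (G.transformAt A σ).MaxStrategy
  | .inl x, hx => ⟨G.redirect A x (ρ x hx).1, (ρ x hx).1, (ρ x hx).2, rfl⟩
  | .inr _, hx => nomatch hx

end

end SSG

/-! No stopping assumption is available, so the optimality equations may have several solutions.
What replaces uniqueness is leastness: `maxVal` is the least supersolution of these equations, by
`IsSupersolution.maxVal_le` and `tendsto_iter_and_isSupersolution`. Setting a value vector to zero
on a trap (a sink-free set that min can keep the play in) leaves a supersolution, so values vanish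
on traps: `maxVal_eq_zero_of_trap`.

Leastness, applied once in each game, gives `transVal_self`: redirecting arcs to sinks worth `v_σ`
does not change the value of `σ`. It remains to show `W ≤ z`, where `W` and `z` are the values of
`σ'` in `G[A, σ]` and in `G` (`transVal_le_maxVal`). Suppose that `W - z` has maximum `M > 0`,
attained on `S`. The optimality equations make `S` a trap for `σ'` in `G`, so `z = 0` and `W = M` on
`S`. If `v_σ = M` somewhere on `S`, then `σ` and `σ'` agree at the max vertices of that part of `S`;
the part is a trap for `σ`, which forces `v_σ = 0` there. Otherwise none of the arcs that keep the
play in `S` is redirected, so `S` is a trap in `G[A, σ]` and `W = 0` on it. Both cases contradict `M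
> 0`. -/

namespace SSG

/-! ### Random plays -/

theorem next_max (G : SSG) (σ : G.GenMaxStrategy) (τ : G.GenMinStrategy) {n : ℕ} (h : G.Hist n)
    (hk : G.kind (G.last h) = .max) : G.next σ τ n h = PMF.pure (σ n h hk).1 := by
  unfold next
  split <;> rename_i e <;> first | rfl | nomatch hk.symm.trans e

theorem next_min (G : SSG) (σ : G.GenMaxStrategy) (τ : G.GenMinStrategy) {n : ℕ} (h : G.Hist n)
    (hk : G.kind (G.last h) = .min) : G.next σ τ n h = PMF.pure (τ n h hk).1 := by
  unfold next
  split <;> rename_i e <;> first | rfl | nomatch hk.symm.trans e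

theorem next_random (G : SSG) (σ : G.GenMaxStrategy) (τ : G.GenMinStrategy) {n : ℕ} (h : G.Hist n)
    (hk : G.kind (G.last h) = .random) : G.next σ τ n h = G.prob (G.last h) hk := by
  unfold next
  split <;> rename_i e <;> first | rfl | nomatch hk.symm.trans e

theorem next_sink (G : SSG) (σ : G.GenMaxStrategy) (τ : G.GenMinStrategy) {n : ℕ} (h : G.Hist n)
    (hk : G.kind (G.last h) = .sink) : G.next σ τ n h = PMF.pure (G.last h) := by
  unfold next
  split <;> rename_i e <;> first | rfl | nomatch hk.symm.trans e

theorem integral_pmf_pure (G : SSG) (f : G.V → ℝ) (y : G.V) :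
    ∫ z, f z ∂(PMF.pure y).toMeasure = f y := by
  rw [PMF.toMeasure_pure, integral_dirac]

/-- The history `(X_0, …, X_n)` of the play `X`. -/
abbrev hist (G : SSG) (n : ℕ) (X : ℕ → G.V) : G.Hist n := Preorder.frestrictLe n X

/-- The law of `(X_0, …, X_n)` and `X_{n+1}`. -/
theorem map_playLaw_hist_succ (G : SSG) (σ : G.GenMaxStrategy) (τ : G.GenMinStrategy) (x : G.V)
    (n : ℕ) :
    (G.playLaw σ τ x).map (fun X => (G.hist n X, X (n + 1))) =
      (G.playLaw σ τ x).map (G.hist n) ⊗ₘ G.nextKernel σ τ n := by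
  unfold playLaw hist
  rw [Kernel.traj_map_frestrictLe_apply]
  exact (Kernel.partialTraj_compProd_eq_map_traj (X := fun _ => G.V) (Nat.zero_le n)).symm

/-- The tower property. It reduces every later estimate on plays to an inequality about a single
move. -/
theorem integral_hist_succ (G : SSG) (σ : G.GenMaxStrategy) (τ : G.GenMinStrategy) (x : G.V)
    (n : ℕ) (F : G.Hist n → G.V → ℝ) :
    ∫ X, F (G.hist n X) (X (n + 1)) ∂(G.playLaw σ τ x) =
      ∫ X, ∫ y, F (G.hist n X) y ∂(G.next σ τ n (G.hist n X)).toMeasure ∂(G.playLaw σ τ x) := by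
  have hm : Measurable (fun X : ℕ → G.V => (G.hist n X, X (n + 1))) := by
    unfold hist; fun_prop
  have hm' : Measurable (G.hist n) := by unfold hist; fun_prop
  have : IsProbabilityMeasure ((G.playLaw σ τ x).map (G.hist n)) :=
    Measure.isProbabilityMeasure_map hm'.aemeasurable
  have e := integral_map (μ := G.playLaw σ τ x) hm.aemeasurable
    (f := fun p : G.Hist n × G.V => F p.1 p.2) Measurable.of_discrete.aestronglyMeasurable
  rw [← e, map_playLaw_hist_succ, Measure.integral_compProd .of_finite,
    integral_map hm'.aemeasurable Measurable.of_discrete.aestronglyMeasurable]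
  rfl

theorem integrable_comp_hist (G : SSG) (σ : G.GenMaxStrategy) (τ : G.GenMinStrategy) (x : G.V)
    (n : ℕ) (F : G.Hist n → ℝ) : Integrable (fun X => F (G.hist n X)) (G.playLaw σ τ x) := by
  have hm' : Measurable (G.hist n) := by unfold hist; fun_prop
  have : IsProbabilityMeasure ((G.playLaw σ τ x).map (G.hist n)) :=
    Measure.isProbabilityMeasure_map hm'.aemeasurable
  exact (Integrable.of_finite (f := F) (μ := (G.playLaw σ τ x).map (G.hist n))).comp_measurable hm'

theorem integrable_hist_succ (G : SSG) (σ : G.GenMaxStrategy) (τ : G.GenMinStrategy) (x : G.V)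
    (n : ℕ) (F : G.Hist n → G.V → ℝ) :
    Integrable (fun X => F (G.hist n X) (X (n + 1))) (G.playLaw σ τ x) :=
  G.integrable_comp_hist σ τ x (n + 1) fun h =>
    F (Preorder.frestrictLe₂ (π := fun _ => G.V) n.le_succ h) (G.last h)

theorem integral_apply_zero (G : SSG) (σ : G.GenMaxStrategy) (τ : G.GenMinStrategy) (x : G.V)
    (f : G.V → ℝ) : ∫ X, f (X 0) ∂(G.playLaw σ τ x) = f x := by
  have hm' : Measurable (G.hist 0) := by unfold hist; fun_prop
  have h0 : (G.playLaw σ τ x).map (G.hist 0) = Measure.dirac (fun _ => x) := by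
    unfold playLaw hist
    rw [Kernel.traj_map_frestrictLe_apply, Kernel.partialTraj_self, Kernel.id_apply]
  have e := integral_map (μ := G.playLaw σ τ x) hm'.aemeasurable
    (f := fun h : G.Hist 0 => f (G.last h)) Measurable.of_discrete.aestronglyMeasurable
  rw [h0, integral_dirac] at e
  exact e.symm

theorem integral_apply_le_succ (G : SSG) (σ : G.GenMaxStrategy) (τ : G.GenMinStrategy) (x : G.V)
    (n : ℕ) {a b : G.V → ℝ}
    (hab : ∀ h : G.Hist n, a (G.last h) ≤ ∫ y, b y ∂(G.next σ τ n h).toMeasure) :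
    ∫ X, a (X n) ∂(G.playLaw σ τ x) ≤ ∫ X, b (X (n + 1)) ∂(G.playLaw σ τ x) := by
  rw [G.integral_hist_succ σ τ x n fun _ y => b y]
  exact integral_mono (G.integrable_comp_hist σ τ x n fun h => a (G.last h))
    (G.integrable_comp_hist σ τ x n fun h => ∫ y, b y ∂(G.next σ τ n h).toMeasure)
    fun X => hab (G.hist n X)

theorem integral_apply_succ_le (G : SSG) (σ : G.GenMaxStrategy) (τ : G.GenMinStrategy) (x : G.V)
    (n : ℕ) {a b : G.V → ℝ}
    (hab : ∀ h : G.Hist n, ∫ y, b y ∂(G.next σ τ n h).toMeasure ≤ a (G.last h)) :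
    ∫ X, b (X (n + 1)) ∂(G.playLaw σ τ x) ≤ ∫ X, a (X n) ∂(G.playLaw σ τ x) := by
  rw [G.integral_hist_succ σ τ x n fun _ y => b y]
  exact integral_mono
    (G.integrable_comp_hist σ τ x n fun h => ∫ y, b y ∂(G.next σ τ n h).toMeasure)
    (G.integrable_comp_hist σ τ x n fun h => a (G.last h)) fun X => hab (G.hist n X)

/-- Almost surely, the play stays at a sink that it has reached. -/
theorem ae_absorbed (G : SSG) (σ : G.GenMaxStrategy) (τ : G.GenMinStrategy) (x : G.V) :
    ∀ᵐ X ∂(G.playLaw σ τ x), ∀ n, G.kind (X n) = .sink → X (n + 1) = X n := by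
  classical
  rw [ae_all_iff]
  intro n
  -- Indicator of leaving a sink at time `n`; being nonnegative with expectation zero, it vanishes
  -- almost surely.
  let F : G.Hist n → G.V → ℝ := fun h y => if G.kind (G.last h) = .sink → y = G.last h then 0 else 1
  have h0 : ∫ X, F (G.hist n X) (X (n + 1)) ∂(G.playLaw σ τ x) = 0 := by
    rw [integral_hist_succ]
    have : ∀ h : G.Hist n, ∫ y, F h y ∂(G.next σ τ n h).toMeasure = 0 := by
      intro h
      by_cases hk : G.kind (G.last h) = .sink
      · rw [G.next_sink σ τ h hk, integral_pmf_pure]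
        simp [F]
      · simp [F, hk]
    simp [this]
  have hi : Integrable (fun X => F (G.hist n X) (X (n + 1))) (G.playLaw σ τ x) :=
    G.integrable_hist_succ σ τ x n F
  have hF : ∀ h y, 0 ≤ F h y := fun h y => by
    change 0 ≤ ite _ _ _
    split_ifs <;> norm_num
  rw [integral_eq_zero_iff_of_nonneg (fun X => hF _ _) hi] at h0
  filter_upwards [h0] with X hX
  by_contra hc
  have : F (G.hist n X) (X (n + 1)) = 1 := if_neg hc
  simp [this] at hX

/-! ### The value as a limit of expected sink rewards -/

open Classical in
/-- The value of a sink, and `0` at the other vertices. -/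
noncomputable def sinkReward (G : SSG) (x : G.V) : ℝ :=
  if h : G.kind x = .sink then (G.sinkVal x h : ℝ) else 0

theorem sinkReward_of_sink (G : SSG) {x : G.V} (h : G.kind x = .sink) :
    G.sinkReward x = G.sinkVal x h := dif_pos h

theorem sinkReward_of_ne (G : SSG) {x : G.V} (h : G.kind x ≠ .sink) : G.sinkReward x = 0 :=
  dif_neg h

theorem sinkReward_mem (G : SSG) (x : G.V) : G.sinkReward x ∈ unitInterval := by
  unfold sinkReward
  split_ifs
  · exact Subtype.property _
  · simp

theorem tendsto_sinkReward (G : SSG) {X : ℕ → G.V}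
    (hX : ∀ n, G.kind (X n) = .sink → X (n + 1) = X n) :
    Filter.Tendsto (fun n => G.sinkReward (X n)) Filter.atTop (nhds (G.playVal X)) := by
  classical
  unfold playVal
  split_ifs with h
  · have hs := Nat.find_spec h
    have hc : ∀ n ≥ Nat.find h, X n = X (Nat.find h) := by
      intro n hn
      induction n, hn using Nat.le_induction with
      | base => rfl
      | succ n hn ih => rw [hX n (ih ▸ hs), ih]
    refine tendsto_const_nhds.congr' ?_
    filter_upwards [Filter.eventually_ge_atTop (Nat.find h)] with n hn
    rw [hc n hn, G.sinkReward_of_sink hs]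
  · push Not at h
    simp [G.sinkReward_of_ne (h _)]

/-- Absorption at sinks gives almost sure convergence of the rewards, and they are bounded by 1.
Comparisons at finite times thereby pass to values. -/
theorem tendsto_integral_sinkReward (G : SSG) (σ : G.GenMaxStrategy) (τ : G.GenMinStrategy)
    (x : G.V) :
    Filter.Tendsto (fun n => ∫ X, G.sinkReward (X n) ∂(G.playLaw σ τ x)) Filter.atTop
      (nhds (G.value σ τ x)) := by
  refine tendsto_integral_of_dominated_convergence (fun _ => 1)
    (fun n => (G.integrable_comp_hist σ τ x n fun h => G.sinkReward (G.last h)).1)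
    (integrable_const _) (fun n => .of_forall fun X => ?_) ?_
  · rw [Real.norm_of_nonneg (G.sinkReward_mem _).1]
    exact (G.sinkReward_mem _).2
  · filter_upwards [G.ae_absorbed σ τ x] with X hX
    exact G.tendsto_sinkReward hX

/-! ### The value vector as least supersolution of the optimality equations -/

theorem integral_prob_mono (G : SSG) {x : G.V} (hx : G.kind x = .random) {f g : G.V → ℝ}
    (h : ∀ y, G.Adj x y → f y ≤ g y) :
    ∫ y, f y ∂(G.prob x hx).toMeasure ≤ ∫ y, g y ∂(G.prob x hx).toMeasure := by
  have := Fintype.ofFinite G.V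
  rw [PMF.integral_eq_sum, PMF.integral_eq_sum]
  refine Finset.sum_le_sum fun y _ => ?_
  by_cases hy : G.Adj x y
  · exact mul_le_mul_of_nonneg_left (h y hy) ENNReal.toReal_nonneg
  · rw [G.adj_random x hx, pos_iff_ne_zero, not_not] at hy
    simp [hy]

theorem integral_prob_lt (G : SSG) {x : G.V} (hx : G.kind x = .random) {f g : G.V → ℝ}
    (h : ∀ y, G.Adj x y → f y ≤ g y) {y : G.V} (hy : G.Adj x y) (hlt : f y < g y) :
    ∫ y, f y ∂(G.prob x hx).toMeasure < ∫ y, g y ∂(G.prob x hx).toMeasure := by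
  have := Fintype.ofFinite G.V
  rw [PMF.integral_eq_sum, PMF.integral_eq_sum]
  refine Finset.sum_lt_sum (fun z _ => ?_) ⟨y, Finset.mem_univ y, ?_⟩
  · by_cases hz : G.Adj x z
    · exact mul_le_mul_of_nonneg_left (h z hz) ENNReal.toReal_nonneg
    · rw [G.adj_random x hx, pos_iff_ne_zero, not_not] at hz
      simp [hz]
  · exact mul_lt_mul_of_pos_left hlt
      (ENNReal.toReal_pos ((G.adj_random x hx y).1 hy).ne' (PMF.apply_ne_top _ _))

theorem tendsto_integral_prob (G : SSG) {x : G.V} (hx : G.kind x = .random) {f : ℕ → G.V → ℝ}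
    {g : G.V → ℝ} (h : ∀ y, Filter.Tendsto (fun n => f n y) Filter.atTop (nhds (g y))) :
    Filter.Tendsto (fun n => ∫ y, f n y ∂(G.prob x hx).toMeasure) Filter.atTop
      (nhds (∫ y, g y ∂(G.prob x hx).toMeasure)) := by
  have := Fintype.ofFinite G.V
  simp_rw [PMF.integral_eq_sum]
  exact tendsto_finsetSum _ fun y _ => (h y).const_smul _

/-- Nonnegative functions that do not increase in expectation if max plays `σ` and min plays
suitably, and that are at least the values of the sinks. -/
structure IsSupersolution (G : SSG) (σ : G.MaxStrategy) (f : G.V → ℝ) : Prop where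
  nonneg : ∀ x, 0 ≤ f x
  max_le : ∀ x (hx : G.kind x = .max), f (σ x hx).1 ≤ f x
  min_le : ∀ x, G.kind x = .min → ∃ y, G.Adj x y ∧ f y ≤ f x
  random_le : ∀ x (hx : G.kind x = .random), ∫ y, f y ∂(G.prob x hx).toMeasure ≤ f x
  sink_le : ∀ s (hs : G.kind s = .sink), (G.sinkVal s hs : ℝ) ≤ f s

/-- Against the positional min strategy that picks the arcs from `min_le`, the process `f (X n)` is
a supermartingale dominating the sink reward. -/
theorem IsSupersolution.maxVal_le {G : SSG} {σ : G.MaxStrategy} {f : G.V → ℝ}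
    (hf : G.IsSupersolution σ f) (x : G.V) : G.maxVal σ x ≤ f x := by
  choose t ht htf using hf.min_le
  let τ : G.MinStrategy := fun x hx => ⟨t x hx, ht x hx⟩
  refine (ciInf_le (G.bddBelow_value _ x) τ.toGen).trans ?_
  have hE : ∀ n, ∫ X, f (X n) ∂(G.playLaw σ.toGen τ.toGen x) ≤ f x := by
    intro n
    induction n with
    | zero => exact (G.integral_apply_zero _ _ x f).le
    | succ n ih =>
      refine (G.integral_apply_succ_le _ _ x n fun h => ?_).trans ih
      cases hk : G.kind (G.last h) with
      | max => rw [G.next_max _ _ h hk, integral_pmf_pure]; exact hf.max_le _ hk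
      | min => rw [G.next_min _ _ h hk, integral_pmf_pure]; exact htf _ hk
      | random => rw [G.next_random _ _ h hk]; exact hf.random_le _ hk
      | sink => rw [G.next_sink _ _ h hk, integral_pmf_pure]
  refine le_of_tendsto (G.tendsto_integral_sinkReward σ.toGen τ.toGen x) (.of_forall fun n => ?_)
  refine le_trans (integral_mono (G.integrable_comp_hist _ _ x n fun h => G.sinkReward (G.last h))
    (G.integrable_comp_hist _ _ x n fun h => f (G.last h)) fun X => ?_) (hE n)
  change G.sinkReward (X n) ≤ f (X n)
  by_cases hk : G.kind (X n) = .sink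
  · rw [G.sinkReward_of_sink hk]; exact hf.sink_le _ hk
  · rw [G.sinkReward_of_ne hk]; exact hf.nonneg _

/-! ### Value iteration -/

/-- The optimality operator of the game in which max plays `σ`. -/
noncomputable def step (G : SSG) (σ : G.MaxStrategy) (f : G.V → ℝ) (x : G.V) : ℝ :=
  match hk : G.kind x with
  | .max => f (σ x hk).1
  | .min => ⨅ y : {y : G.V // G.Adj x y}, f y
  | .random => ∫ y, f y ∂(G.prob x hk).toMeasure
  | .sink => G.sinkVal x hk

section step

variable (G : SSG) (σ : G.MaxStrategy) (f : G.V → ℝ) {x : G.V}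

theorem step_max (hk : G.kind x = .max) : G.step σ f x = f (σ x hk).1 := by
  unfold step
  split <;> rename_i e <;> first | rfl | nomatch hk.symm.trans e

theorem step_min (hk : G.kind x = .min) :
    G.step σ f x = ⨅ y : {y : G.V // G.Adj x y}, f y := by
  unfold step
  split <;> rename_i e <;> first | rfl | nomatch hk.symm.trans e

theorem step_random (hk : G.kind x = .random) :
    G.step σ f x = ∫ y, f y ∂(G.prob x hk).toMeasure := by
  unfold step
  split <;> rename_i e <;> first | rfl | nomatch hk.symm.trans e

theorem step_sink (hk : G.kind x = .sink) : G.step σ f x = G.sinkVal x hk := by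
  unfold step
  split <;> rename_i e <;> first | rfl | nomatch hk.symm.trans e

theorem step_min_le (hk : G.kind x = .min) {y : G.V} (hy : G.Adj x y) : G.step σ f x ≤ f y := by
  rw [G.step_min σ f hk]
  exact ciInf_le (f := fun y : {y : G.V // G.Adj x y} => f y) (Set.finite_range _).bddBelow ⟨y, hy⟩

theorem exists_step_min_eq (hk : G.kind x = .min) : ∃ y, G.Adj x y ∧ f y = G.step σ f x := by
  obtain ⟨y₀, hy₀⟩ := G.exists_adj x (by simp [hk])
  have : Nonempty {y : G.V // G.Adj x y} := ⟨⟨y₀, hy₀⟩⟩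
  obtain ⟨y, hy⟩ := exists_eq_ciInf_of_finite (f := fun y : {y : G.V // G.Adj x y} => f y)
  exact ⟨y, y.2, by rw [hy, G.step_min σ f hk]⟩

theorem step_mono : Monotone (G.step σ) := by
  intro f g hfg x
  cases hk : G.kind x with
  | max => rw [G.step_max σ _ hk, G.step_max σ _ hk]; exact hfg _
  | min =>
    obtain ⟨y, hy, e⟩ := G.exists_step_min_eq σ g hk
    exact (G.step_min_le σ f hk hy).trans ((hfg y).trans e.le)
  | random =>
    rw [G.step_random σ _ hk, G.step_random σ _ hk]
    exact G.integral_prob_mono hk fun y _ => hfg y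
  | sink => rw [G.step_sink σ _ hk, G.step_sink σ _ hk]

end step

/-- The value of the game that is stopped after `n` steps. -/
noncomputable def iter (G : SSG) (σ : G.MaxStrategy) (n : ℕ) : G.V → ℝ :=
  (G.step σ)^[n] G.sinkReward

section iter

variable (G : SSG) (σ : G.MaxStrategy)

theorem iter_succ (n : ℕ) : G.iter σ (n + 1) = G.step σ (G.iter σ n) :=
  Function.iterate_succ_apply' _ _ _

theorem iter_sink (n : ℕ) {x : G.V} (hk : G.kind x = .sink) : G.iter σ n x = G.sinkVal x hk := by
  cases n with
  | zero => exact G.sinkReward_of_sink hk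
  | succ n => rw [iter_succ, G.step_sink σ _ hk]

theorem sinkReward_le_step : G.sinkReward ≤ G.step σ G.sinkReward := by
  intro x
  cases hk : G.kind x with
  | max =>
    rw [G.step_max σ _ hk, G.sinkReward_of_ne (by simp [hk])]
    exact (G.sinkReward_mem _).1
  | min =>
    obtain ⟨y, -, e⟩ := G.exists_step_min_eq σ G.sinkReward hk
    rw [← e, G.sinkReward_of_ne (by simp [hk])]
    exact (G.sinkReward_mem _).1
  | random =>
    rw [G.step_random σ _ hk, G.sinkReward_of_ne (by simp [hk])]
    exact integral_nonneg fun y => (G.sinkReward_mem y).1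
  | sink => rw [G.step_sink σ _ hk, G.sinkReward_of_sink hk]

theorem iter_mono : Monotone (G.iter σ) := by
  refine monotone_nat_of_le_succ fun n => ?_
  induction n with
  | zero => exact G.sinkReward_le_step σ
  | succ n ih => rw [iter_succ, iter_succ _ _ (n + 1)]; exact G.step_mono σ ih

/-- Whatever min does, the value with the remaining horizon is a submartingale: each move uses up
one step of the horizon. The case `k = 0` bounds `iter` by the expected reward at time `m`. -/
theorem iter_add_le_integral (τ : G.GenMinStrategy) (x : G.V) (m k : ℕ) :
    G.iter σ (k + m) x ≤ ∫ X, G.iter σ k (X m) ∂(G.playLaw σ.toGen τ x) := by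
  induction m generalizing k with
  | zero => exact (G.integral_apply_zero _ _ x _).ge
  | succ m ih =>
    rw [show k + (m + 1) = k + 1 + m by omega]
    refine (ih (k + 1)).trans (G.integral_apply_le_succ _ _ x m fun h => ?_)
    cases hk : G.kind (G.last h) with
    | max =>
      rw [G.next_max _ _ h hk, integral_pmf_pure, iter_succ, G.step_max σ _ hk]; rfl
    | min =>
      rw [G.next_min _ _ h hk, integral_pmf_pure, iter_succ]
      exact G.step_min_le σ _ hk (τ m h hk).2
    | random => rw [G.next_random _ _ h hk, iter_succ, G.step_random σ _ hk]
    | sink =>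
      rw [G.next_sink _ _ h hk, integral_pmf_pure, G.iter_sink σ _ hk, G.iter_sink σ _ hk]

theorem iter_le_value (τ : G.GenMinStrategy) (x : G.V) (n : ℕ) :
    G.iter σ n x ≤ G.value σ.toGen τ x := by
  refine ge_of_tendsto (G.tendsto_integral_sinkReward σ.toGen τ x) ?_
  filter_upwards [Filter.eventually_ge_atTop n] with m hm
  have := G.iter_add_le_integral σ τ x m 0
  rw [Nat.zero_add] at this
  exact (G.iter_mono σ hm x).trans this

theorem iter_le_maxVal (x : G.V) (n : ℕ) : G.iter σ n x ≤ G.maxVal σ x :=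
  le_ciInf fun τ => G.iter_le_value σ τ x n

/-- Value iteration converges to the value vector, which is a supersolution. -/
theorem tendsto_iter_and_isSupersolution :
    (∀ x, Filter.Tendsto (fun n => G.iter σ n x) Filter.atTop (nhds (G.maxVal σ x))) ∧
      G.IsSupersolution σ (G.maxVal σ) := by
  have hb : ∀ x, BddAbove (Set.range fun n => G.iter σ n x) := fun x =>
    ⟨G.maxVal σ x, by rintro _ ⟨n, rfl⟩; exact G.iter_le_maxVal σ x n⟩
  have hL : ∀ x, Filter.Tendsto (fun n => G.iter σ n x) Filter.atTop
      (nhds (⨆ n, G.iter σ n x)) := fun x =>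
    tendsto_atTop_ciSup (fun m n hmn => G.iter_mono σ hmn x) (hb x)
  have hle : ∀ x n, G.iter σ n x ≤ ⨆ n, G.iter σ n x := fun x n => le_ciSup (hb x) n
  have hs : G.IsSupersolution σ fun x => ⨆ n, G.iter σ n x :=
    { nonneg := fun x => (G.sinkReward_mem x).1.trans (hle x 0)
      max_le := fun x hx => ciSup_le fun n => by
        rw [← G.step_max σ (G.iter σ n) hx, ← iter_succ]
        exact hle x _
      min_le := by
        intro x hx
        by_contra! hc
        -- Finiteness of `V` yields one `n` that works for all outneighbours; one more iteration
        -- then exceeds the supremum at `x`.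
        have hev : ∀ᶠ n in Filter.atTop, ∀ y, G.Adj x y → ⨆ n, G.iter σ n x < G.iter σ n y := by
          rw [Filter.eventually_all]
          intro y
          by_cases hy : G.Adj x y
          · filter_upwards [(hL y).eventually_const_lt (hc y hy)] with n hn using fun _ => hn
          · exact .of_forall fun n h => absurd h hy
        obtain ⟨n, hn⟩ := hev.exists
        obtain ⟨y, hy, e⟩ := G.exists_step_min_eq σ (G.iter σ n) hx
        have := hn y hy
        rw [e, ← iter_succ] at this
        exact (hle x _).not_gt this
      random_le := fun x hx => by
        refine le_of_tendsto (G.tendsto_integral_prob hx hL) (.of_forall fun n => ?_)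
        rw [← G.step_random σ _ hx, ← iter_succ]
        exact hle x _
      sink_le := fun s hk => (G.iter_sink σ 0 hk).ge.trans (hle s 0) }
  -- The iterates lie below the value, and their supremum is a supersolution, hence lies above it.
  have e : (fun x => ⨆ n, G.iter σ n x) = G.maxVal σ := funext fun x =>
    le_antisymm (ciSup_le (G.iter_le_maxVal σ x)) (hs.maxVal_le x)
  exact ⟨fun x => congrFun e x ▸ hL x, e ▸ hs⟩

theorem tendsto_iter (x : G.V) :
    Filter.Tendsto (fun n => G.iter σ n x) Filter.atTop (nhds (G.maxVal σ x)) :=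
  (G.tendsto_iter_and_isSupersolution σ).1 x

/-- This optimality equation and those for the other kinds of vertices are limits of the recursion
for `iter`. -/
theorem maxVal_max {x : G.V} (hx : G.kind x = .max) : G.maxVal σ x = G.maxVal σ (σ x hx).1 := by
  refine tendsto_nhds_unique ((Filter.tendsto_add_atTop_iff_nat 1).2 (G.tendsto_iter σ x)) ?_
  simp_rw [iter_succ, G.step_max σ _ hx]
  exact G.tendsto_iter σ _

theorem maxVal_random {x : G.V} (hx : G.kind x = .random) :
    G.maxVal σ x = ∫ y, G.maxVal σ y ∂(G.prob x hx).toMeasure := by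
  refine tendsto_nhds_unique ((Filter.tendsto_add_atTop_iff_nat 1).2 (G.tendsto_iter σ x)) ?_
  simp_rw [iter_succ, G.step_random σ _ hx]
  exact G.tendsto_integral_prob hx (G.tendsto_iter σ)

theorem maxVal_sink {x : G.V} (hx : G.kind x = .sink) : G.maxVal σ x = G.sinkVal x hx := by
  refine tendsto_nhds_unique (G.tendsto_iter σ x) ?_
  simp_rw [G.iter_sink σ _ hx]
  exact tendsto_const_nhds

theorem maxVal_min_le {x y : G.V} (hx : G.kind x = .min) (hy : G.Adj x y) :
    G.maxVal σ x ≤ G.maxVal σ y := by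
  refine le_of_tendsto_of_tendsto'
    ((Filter.tendsto_add_atTop_iff_nat 1).2 (G.tendsto_iter σ x)) (G.tendsto_iter σ y) fun n => ?_
  rw [iter_succ]
  exact G.step_min_le σ _ hx hy

theorem exists_maxVal_min_eq {x : G.V} (hx : G.kind x = .min) :
    ∃ y, G.Adj x y ∧ G.maxVal σ y = G.maxVal σ x := by
  obtain ⟨y, hy, h⟩ := (G.tendsto_iter_and_isSupersolution σ).2.min_le x hx
  exact ⟨y, hy, h.antisymm (G.maxVal_min_le σ hx hy)⟩

end iter

/-! ### Traps -/

/-- Let `D` be a set without sinks that the play does not leave if max plays `σ` and min plays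
suitably. Then `σ` guarantees nothing on `D`. -/
theorem maxVal_eq_zero_of_trap (G : SSG) (σ : G.MaxStrategy) (D : Set G.V)
    (hmax : ∀ x ∈ D, ∀ hx : G.kind x = .max, (σ x hx).1 ∈ D)
    (hmin : ∀ x ∈ D, G.kind x = .min → ∃ y ∈ D, G.Adj x y)
    (hrandom : ∀ x ∈ D, G.kind x = .random → ∀ y, G.Adj x y → y ∈ D)
    (hsink : ∀ x ∈ D, G.kind x ≠ .sink) {x : G.V} (hx : x ∈ D) : G.maxVal σ x = 0 := by
  have h0 : ∀ y, 0 ≤ Dᶜ.indicator (G.maxVal σ) y := fun y =>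
    Set.indicator_nonneg (fun z _ => (G.maxVal_mem σ z).1) y
  have hle : ∀ y, Dᶜ.indicator (G.maxVal σ) y ≤ G.maxVal σ y := fun y =>
    Set.indicator_le_self' (fun z _ => (G.maxVal_mem σ z).1) y
  have hin : ∀ y ∈ D, Dᶜ.indicator (G.maxVal σ) y = 0 := fun y hy =>
    Set.indicator_of_notMem (not_not_intro hy) _
  have hout : ∀ y ∉ D, Dᶜ.indicator (G.maxVal σ) y = G.maxVal σ y := fun y hy =>
    Set.indicator_of_mem (s := Dᶜ) hy _
  -- Outside `D` the inequalities survive because lowering `f` at successors only helps; inside `D`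
  -- some move of min, and every other move, stays where the function is zero.
  have hs : G.IsSupersolution σ (Dᶜ.indicator (G.maxVal σ)) :=
    { nonneg := h0
      max_le := fun y hy => by
        by_cases hD : y ∈ D
        · rw [hin _ (hmax y hD hy)]; exact h0 y
        · rw [hout y hD, G.maxVal_max σ hy]; exact hle _
      min_le := fun y hy => by
        by_cases hD : y ∈ D
        · obtain ⟨z, hz, hyz⟩ := hmin y hD hy
          exact ⟨z, hyz, (hin z hz).le.trans (h0 y)⟩
        · obtain ⟨z, hyz, e⟩ := G.exists_maxVal_min_eq σ hy
          exact ⟨z, hyz, by rw [hout y hD, ← e]; exact hle z⟩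
      random_le := fun y hy => by
        by_cases hD : y ∈ D
        · refine (G.integral_prob_mono hy (g := fun _ => 0) fun z hz => ?_).trans ?_
          · exact (hin z (hrandom y hD hy z hz)).le
          · simpa using h0 y
        · rw [hout y hD, G.maxVal_random σ hy]
          exact G.integral_prob_mono hy fun z _ => hle z
      sink_le := fun y hy => by
        rw [hout y fun hD => hsink y hD hy, G.maxVal_sink σ hy] }
  exact le_antisymm ((hs.maxVal_le x).trans (hin x hx).le) (G.maxVal_mem σ x).1

/-! ### Values in the transformed game -/

theorem redirect_cases (G : SSG.{u}) (A : Set (G.V × G.V)) (x y : G.V) :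
    G.redirect A x y = .inl y ∨ ∃ e : A, e.1.2 = y ∧ G.redirect A x y = .inr e := by
  unfold redirect
  split_ifs with h
  · exact .inr ⟨_, rfl, rfl⟩
  · exact .inl rfl

theorem integral_pmf_map {G H : SSG} (p : PMF G.V) (g : G.V → H.V) (f : H.V → ℝ) :
    ∫ b, f b ∂(p.map g).toMeasure = ∫ y, f (g y) ∂p.toMeasure := by
  have hm : Measurable g := .of_discrete
  rw [← PMF.toMeasure_map g p hm,
    integral_map hm.aemeasurable Measurable.of_discrete.aestronglyMeasurable]

section transformAt

variable (G : SSG.{u}) (A : Set (G.V × G.V)) (σ ρ : G.MaxStrategy)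

theorem integral_transformAt_prob {x : G.V} (hx : G.kind x = .random)
    (f : (G.transformAt A σ).V → ℝ) :
    ∫ b, f b ∂((G.transformAt A σ).prob (Sum.inl x) hx).toMeasure =
      ∫ y, f (G.redirect A x y) ∂(G.prob x hx).toMeasure :=
  integral_pmf_map (H := G.transformAt A σ) (G.prob x hx) (G.redirect A x) f

/-- The value of a positional max strategy of `G` in `G[A, σ]`. -/
noncomputable def transVal : G.V ⊕ A → ℝ :=
  (G.transformAt A σ).maxVal (ρ.inTransform A σ)

theorem transVal_inr (e : A) : G.transVal A σ ρ (.inr e) = G.maxVal σ e.1.2 :=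
  (G.transformAt A σ).maxVal_sink (ρ.inTransform A σ) (x := .inr e) rfl

theorem transVal_sink {x : G.V} (hx : G.kind x = .sink) :
    G.transVal A σ ρ (.inl x) = G.sinkVal x hx :=
  (G.transformAt A σ).maxVal_sink (ρ.inTransform A σ) (x := .inl x) hx

theorem transVal_max {x : G.V} (hx : G.kind x = .max) :
    G.transVal A σ ρ (.inl x) = G.transVal A σ ρ (G.redirect A x (ρ x hx).1) :=
  (G.transformAt A σ).maxVal_max (ρ.inTransform A σ) (x := .inl x) hx

theorem transVal_random {x : G.V} (hx : G.kind x = .random) :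
    G.transVal A σ ρ (.inl x) =
      ∫ y, G.transVal A σ ρ (G.redirect A x y) ∂(G.prob x hx).toMeasure :=
  ((G.transformAt A σ).maxVal_random (ρ.inTransform A σ) (x := .inl x) hx).trans
    (G.integral_transformAt_prob A σ hx _)

theorem transVal_min_le {x y : G.V} (hx : G.kind x = .min) (hy : G.Adj x y) :
    G.transVal A σ ρ (.inl x) ≤ G.transVal A σ ρ (G.redirect A x y) :=
  (G.transformAt A σ).maxVal_min_le (ρ.inTransform A σ) (x := .inl x) hx ⟨y, hy, rfl⟩

theorem exists_transVal_min_eq {x : G.V} (hx : G.kind x = .min) :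
    ∃ y, G.Adj x y ∧ G.transVal A σ ρ (G.redirect A x y) = G.transVal A σ ρ (.inl x) := by
  obtain ⟨_, ⟨y, hy, rfl⟩, e⟩ :=
    (G.transformAt A σ).exists_maxVal_min_eq (ρ.inTransform A σ) (x := .inl x) hx
  exact ⟨y, hy, e⟩

theorem transVal_redirect_cases (x y : G.V) :
    G.transVal A σ ρ (G.redirect A x y) = G.transVal A σ ρ (.inl y) ∨
      G.transVal A σ ρ (G.redirect A x y) = G.maxVal σ y := by
  obtain h | ⟨e, he, h⟩ := G.redirect_cases A x y
  · exact .inl (by rw [h])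
  · exact .inr (by rw [h, transVal_inr, he])

/-- The value of `σ` in `G[A, σ]` is its value in `G`. -/
theorem transVal_self (x : G.V) : G.transVal A σ σ (.inl x) = G.maxVal σ x := by
  apply le_antisymm
  · let f : G.V ⊕ A → ℝ := Sum.elim (G.maxVal σ) fun e => G.maxVal σ e.1.2
    have hf : ∀ x y, f (G.redirect A x y) = G.maxVal σ y := by
      intro x y
      obtain h | ⟨e, he, h⟩ := G.redirect_cases A x y
      · rw [h]; rfl
      · rw [h, ← he]; rfl
    have hs : (G.transformAt A σ).IsSupersolution (σ.inTransform A σ) f :=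
      { nonneg := by
          rintro (x | e)
          exacts [(G.maxVal_mem σ x).1, (G.maxVal_mem σ _).1]
        max_le := by
          rintro (x | e) hx
          · exact ((hf _ _).trans (G.maxVal_max σ hx).symm).le
          · nomatch hx
        min_le := by
          rintro (x | e) hx
          · obtain ⟨y, hy, e⟩ := G.exists_maxVal_min_eq σ hx
            exact ⟨_, ⟨y, hy, rfl⟩, ((hf _ _).trans e).le⟩
          · nomatch hx
        random_le := by
          rintro (x | e) hx
          · refine ((G.integral_transformAt_prob A σ hx f).trans ?_).le
            simp_rw [hf]
            exact (G.maxVal_random σ hx).symm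
          · nomatch hx
        sink_le := by
          rintro (x | e) hx
          · exact (G.maxVal_sink σ hx).ge
          · exact le_rfl }
    exact hs.maxVal_le (.inl x)
  · have hr : ∀ x y, min (G.maxVal σ y) (G.transVal A σ σ (.inl y)) ≤
        G.transVal A σ σ (G.redirect A x y) := by
      intro x y
      obtain h | h := G.transVal_redirect_cases A σ σ x y
      · exact (min_le_right _ _).trans_eq h.symm
      · exact (min_le_left _ _).trans_eq h.symm
    -- The transformed value alone need not be a supersolution of `G`, since a redirected arc sees
    -- `v_σ` instead. The minimum with `v_σ` covers both kinds of arcs; at a min vertex, the optimal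
    -- arc for the smaller of the two functions works.
    have hs : G.IsSupersolution σ fun x => min (G.maxVal σ x) (G.transVal A σ σ (.inl x)) :=
      { nonneg := fun x => le_min (G.maxVal_mem σ x).1 ((G.transformAt A σ).maxVal_mem _ _).1
        max_le := fun x hx => le_min ((min_le_left _ _).trans (G.maxVal_max σ hx).ge)
          ((hr x _).trans (G.transVal_max A σ σ hx).ge)
        min_le := fun x hx => by
          obtain h | h := le_total (G.maxVal σ x) (G.transVal A σ σ (.inl x))
          · obtain ⟨y, hy, e⟩ := G.exists_maxVal_min_eq σ hx
            exact ⟨y, hy, by rw [min_eq_left h, ← e]; exact min_le_left _ _⟩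
          · obtain ⟨y, hy, e⟩ := G.exists_transVal_min_eq A σ σ hx
            exact ⟨y, hy, by rw [min_eq_right h, ← e]; exact hr x y⟩
        random_le := fun x hx => by
          rw [G.maxVal_random σ hx, G.transVal_random A σ σ hx]
          exact le_min (G.integral_prob_mono hx fun y _ => min_le_left _ _)
            (G.integral_prob_mono hx fun y _ => hr x y)
        sink_le := fun x hx => by rw [G.maxVal_sink σ hx, G.transVal_sink A σ σ hx, min_self] }
    exact (hs.maxVal_le x).trans (min_le_right _ _)

end transformAt

/-! ### Comparing the two values of the improved strategy -/

/-- If `σ' ≻ σ` in `G[A, σ]`, then the value of `σ'` in `G[A, σ]` is at most its value in `G`. -/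
theorem transVal_le_maxVal (G : SSG.{u}) (A : Set (G.V × G.V)) (σ σ' : G.MaxStrategy)
    (hle : ∀ x, G.maxVal σ x ≤ G.transVal A σ σ' (.inl x))
    (heq : ∀ x (hx : G.kind x = .max), G.transVal A σ σ' (.inl x) = G.maxVal σ x →
      (σ' x hx).1 = (σ x hx).1) (x : G.V) :
    G.transVal A σ σ' (.inl x) ≤ G.maxVal σ' x := by
  set v := G.maxVal σ with hv
  set z := G.maxVal σ' with hz
  set W := G.transVal A σ σ' with hW
  by_contra! hx
  have : Nonempty G.V := ⟨x⟩
  obtain ⟨x₀, hx₀⟩ := Finite.exists_max fun x => W (.inl x) - z x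
  set M := W (.inl x₀) - z x₀ with hM
  have hM0 : 0 < M := by linarith [hx₀ x]
  -- Redirection replaces `W y` by `v y`, which is no larger by `hle`.
  have hredle : ∀ x y, W (G.redirect A x y) ≤ W (.inl y) := fun x y =>
    (G.transVal_redirect_cases A σ σ' x y).elim (·.le) fun h => h.trans_le (hle y)
  let S : Set G.V := {x | W (.inl x) - z x = M}
  have hSsink : ∀ x ∈ S, G.kind x ≠ .sink := by
    intro x hxS hk
    have e : W (.inl x) - z x = M := hxS
    rw [hz, G.maxVal_sink σ' hk, hW, G.transVal_sink A σ σ' hk, sub_self] at e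
    exact hM0.ne e
  -- Equality is forced along `W x ≤ W (redirect x y) ≤ W y ≤ z y + M = z x + M = W x`.
  have hSucc : ∀ {x y}, z x = z y → x ∈ S → W (.inl x) ≤ W (G.redirect A x y) →
      y ∈ S ∧ W (G.redirect A x y) = W (.inl y) := by
    intro x y hzxy hxS hWx
    have e : W (.inl x) - z x = M := hxS
    have := hredle x y
    have := hx₀ y
    refine ⟨?_, ?_⟩
    · change W (.inl y) - z y = M
      linarith
    · linarith
  have hmax : ∀ x ∈ S, ∀ hk : G.kind x = .max,
      (σ' x hk).1 ∈ S ∧ W (G.redirect A x (σ' x hk).1) = W (.inl (σ' x hk).1) :=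
    fun x hxS hk => hSucc (G.maxVal_max σ' hk) hxS (G.transVal_max A σ σ' hk).le
  have hmin : ∀ x ∈ S, G.kind x = .min →
      ∃ y, G.Adj x y ∧ y ∈ S ∧ W (G.redirect A x y) = W (.inl y) := by
    intro x hxS hk
    -- The arc must be optimal for `z`; for `W` any arc gives the required inequality.
    obtain ⟨y, hy, e⟩ := G.exists_maxVal_min_eq σ' hk
    exact ⟨y, hy, hSucc e.symm hxS (G.transVal_min_le A σ σ' hk hy)⟩
  have hrandom : ∀ x ∈ S, G.kind x = .random → ∀ y, G.Adj x y →
      y ∈ S ∧ W (G.redirect A x y) = W (.inl y) := by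
    intro x hxS hk y hy
    have e : W (.inl x) - z x = M := hxS
    -- All outneighbours satisfy the reverse inequality, so one strict instance would make the
    -- average `W x` smaller than `z x + M`.
    have hge : z y + M ≤ W (G.redirect A x y) := by
      by_contra! hlt
      have := G.integral_prob_lt hk (f := fun y => W (G.redirect A x y)) (g := fun y => z y + M)
        (fun y _ => by linarith [hredle x y, hx₀ y]) hy hlt
      rw [← G.transVal_random A σ σ' hk, integral_add .of_finite .of_finite,
        ← G.maxVal_random σ' hk, integral_const, probReal_univ, one_smul] at this
      linarith
    have := hredle x y
    have := hx₀ y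
    refine ⟨?_, ?_⟩
    · change W (.inl y) - z y = M
      linarith
    · linarith
  have hzS : ∀ x ∈ S, z x = 0 := fun x hxS =>
    G.maxVal_eq_zero_of_trap σ' S (fun x hxS hk => (hmax x hxS hk).1)
      (fun x hxS hk => (hmin x hxS hk).imp fun y h => ⟨h.2.1, h.1⟩)
      (fun x hxS hk y hy => (hrandom x hxS hk y hy).1) hSsink hxS
  have hWS : ∀ x ∈ S, W (.inl x) = M := by
    intro x hxS
    have e : W (.inl x) - z x = M := hxS
    rwa [hzS x hxS, sub_zero] at e
  by_cases hex : ∃ x ∈ S, v x = M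
  · obtain ⟨x, hxS, hxM⟩ := hex
    -- Here `v = W = M`, so `heq` makes `σ` follow `σ'`, which stays in `S`. Since `v ≤ W = M` on
    -- `S`, the optimality equations for `v` keep its value at `M` along the moves used.
    have : v x = 0 := G.maxVal_eq_zero_of_trap σ {x | x ∈ S ∧ v x = M}
      (fun x hxS hk => by
        have e := heq x hk ((hWS x hxS.1).trans hxS.2.symm)
        exact ⟨e ▸ (hmax x hxS.1 hk).1, (G.maxVal_max σ hk).symm.trans hxS.2⟩)
      (fun x hxS hk => by
        obtain ⟨y, hy, hyS, -⟩ := hmin x hxS.1 hk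
        exact ⟨y, ⟨hyS, le_antisymm ((hle y).trans (hWS y hyS).le)
          (hxS.2.ge.trans (G.maxVal_min_le σ hk hy))⟩, hy⟩)
      (fun x hxS hk y hy => by
        have hvM : ∀ y, G.Adj x y → v y ≤ M := fun y hy =>
          (hle y).trans (hWS y (hrandom x hxS.1 hk y hy).1).le
        refine ⟨(hrandom x hxS.1 hk y hy).1, (hvM y hy).eq_of_not_lt fun hlt => ?_⟩
        have := G.integral_prob_lt hk (g := fun _ => M) hvM hy hlt
        rw [← G.maxVal_random σ hk, integral_const, probReal_univ, one_smul] at this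
        exact this.ne hxS.2)
      (fun x hxS => hSsink x hxS.1) ⟨hxS, hxM⟩
    exact hM0.ne (this.symm.trans hxM)
  -- If such an arc were redirected, its new sink would have value `v y = W y = M`, which the case
  -- assumption excludes.
  · have hred : ∀ x y, y ∈ S → W (G.redirect A x y) = W (.inl y) →
        G.redirect A x y = .inl y := by
      intro x y hyS e
      obtain h | ⟨a, ha, h⟩ := G.redirect_cases A x y
      · exact h
      · rw [h, hW, transVal_inr, ha, ← hW, hWS y hyS] at e
        exact absurd ⟨y, hyS, e⟩ hex
    have h0 : W (.inl x₀) = 0 := (G.transformAt A σ).maxVal_eq_zero_of_trap (σ'.inTransform A σ)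
      (Sum.inl '' S : Set (G.V ⊕ A))
      (by
        rintro _ ⟨x, hxS, rfl⟩ hk
        exact ⟨_, (hmax x hxS hk).1, (hred x _ (hmax x hxS hk).1 (hmax x hxS hk).2).symm⟩)
      (by
        rintro _ ⟨x, hxS, rfl⟩ hk
        obtain ⟨y, hy, hyS, e⟩ := hmin x hxS hk
        exact ⟨_, ⟨y, hyS, rfl⟩, y, hy, (hred x y hyS e).symm⟩)
      (by
        rintro _ ⟨x, hxS, rfl⟩ hk _ ⟨y, hy, rfl⟩
        obtain ⟨hyS, e⟩ := hrandom x hxS hk y hy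
        exact ⟨y, hyS, (hred x y hyS e).symm⟩)
      (by
        rintro _ ⟨x, hxS, rfl⟩
        exact hSsink x hxS)
      ⟨x₀, rfl, rfl⟩
    exact hM0.ne' ((hWS x₀ rfl).symm.trans h0)

end SSG

theorem mainTheorem4 (G : SSG.{u}) (A : Set (G.V × G.V)) (hA : A ⊆ G.arcs)
    (σ σ' : G.MaxStrategy)
    (h : (G.transformAt A σ).StrictlyBetter (σ'.inTransform A σ) (σ.inTransform A σ)) :
    G.Better σ' σ := by
  obtain ⟨⟨hle, b, hlt⟩, heq⟩ := h
  have hself := G.transVal_self A σ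
  have hw : ∀ x, G.transVal A σ σ' (.inl x) ≤ G.maxVal σ' x := by
    refine G.transVal_le_maxVal A σ σ' (fun x => (hself x).ge.trans (hle (.inl x))) ?_
    intro x hx e
    -- Agreement is known only for the transformed arcs; distinct arcs at `x` stay distinct after
    -- redirection.
    exact G.redirect_injective A x
      (congrArg Subtype.val (heq (.inl x) hx (e.trans (hself x).symm)))
  refine ⟨fun x => (hself x).ge.trans ((hle (.inl x)).trans (hw x)), ?_⟩
  -- The strict improvement occurs at a vertex of `G`, because a new sink has the same value under
  -- both strategies.
  obtain x | e := b
  · exact ⟨x, (hself x).ge.trans_lt (hlt.trans_le (hw x))⟩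
  · exact absurd ((G.transVal_inr A σ σ e).trans (G.transVal_inr A σ σ' e).symm) hlt.ne
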